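/- Let $\mathcal L_n$ be the compact convex set of quantum channels on $\mathbb C^{n\times n}$, i.e. of linear maps $L:\mathbb C^{n\times n}\to\mathbb C^{n\times n}$ that are trace preserving and completely positive ($L(X)=\sum_{i=1}^k A_iXA_i^*$ for some $A_i\in\mathbb C^{n\times n}$). The Choi matrix of $L$ is the $n^2\times n^2$ matrix $Z(L)=[L(E_{ij})]_{i,j=1}^n$, an $n\times n$ array of $n\times n$ blocks. For $L\in\mathcal L_n$ let $\mathcal F(L)$ be the smallest face of $\mathcal L_n$ that contains $L$, and let $\dim\mathcal F(L)$ be its real affine dimension. Consider channels $L\in\mathcal L_n$ with $\operatorname{rank} Z(L)=2$. (i) If $n=2$, then $\dim\mathcal F(L)\in\{0,2\}$, and both values are attained. (ii) If $n\ge 3$, then $\dim\mathcal F(L)\in\{0,1,2\}$, and, for every $n\ge 3$, all three values are attained. Explicit examples are the following. Dimension $0$, for every $n\ge2$: the channel with $Z(L)=yy^*+zz^*$, where $y=(e_1^t,0^t,\dots,0^t)^t$ and $z=(0^t,e_1^t,e_2^t,\dots,e_{n-1}^t)^t$ in $\mathbb C^{n^2}$. It has Choi rank $2$ and $\dim\mathcal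 F(L)=0$. Dimension $2$, for every $n\ge2$: let $B=Z(M)$ for any $M\in\mathcal L_{n-1}$ with $\operatorname{rank}Z(M)=1$. Let $A\in\mathbb C^{n^2\times n^2}$ have entry $1$ at position $(1,1)$ and $B$ as its principal submatrix on the index set $S=[n^2]\setminus\{1,2,\dots,n,n+1,2n+1,\dots,(n-1)n+1\}$, all other entries being $0$. Then $A=Z(L)$ for a channel $L\in\mathcal L_n$ of Choi rank $2$ with $\dim\mathcal F(L)=2$. Dimension $1$, for every $n\ge3$: the matrix $$P=\begin{bmatrix}1&\frac{9}{4\sqrt6}&\frac{3}{2\sqrt6}\\ \frac{9}{4\sqrt6}&1&\frac14\\ \frac{3}{2\sqrt6}&\frac14&1\end{bmatrix}$$ is positive semidefinite. Let $A^{[n]}=[c_{ij}E_{ij}]_{i,j=1}^n$ with $c_{ij}=P_{\kappa(i)\kappa(j)}$, where $\kappa(i)=1$ for $i\le n-2$, $\kappa(n-1)=2$ and $\kappa(n)=3$. Then the principal submatrix of $A^{[3]}$ on $\{1,5,9\}$ is $P$. For $n\ge4$ the principal submatrix of $A^{[n]}$ on $S$ is $A^{[n-1]}$. For every $n\ge3$,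 $A^{[n]}=Z(L)$ for a channel $L\in\mathcal L_n$ of Choi rank $2$ with $\dim\mathcal F(L)=1$. -/

import Mathlib

open scoped ComplexOrder

noncomputable section

namespace QuantumFaces

/-- The `n × n` complex matrices. -/
abbrev Mat (n : ℕ) : Type := Matrix (Fin n) (Fin n) ℂ

/-- `ℂ^{n² × n²}`, as `n × n` block matrices with `n × n` blocks: the index `(i, a)` is position `a`
inside block `i`. -/
abbrev BlockMat (n : ℕ) : Type := Matrix (Fin n × Fin n) (Fin n × Fin n) ℂ

/-- Complete positivity: `L X = ∑ i, K i * X * (K i)ᴴ` for finitely many matrices `K i`. -/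
def IsCompletelyPositive {n : ℕ} (L : Mat n →ₗ[ℂ] Mat n) : Prop :=
  ∃ (k : ℕ) (K : Fin k → Mat n), ∀ X : Mat n, L X = ∑ i, K i * X * (K i).conjTranspose

/-- The set of quantum channels on `n × n` complex matrices: the completely positive and
trace preserving linear maps. -/
def channels (n : ℕ) : Set (Mat n →ₗ[ℂ] Mat n) :=
  {L | IsCompletelyPositive L ∧ ∀ X : Mat n, (L X).trace = X.trace}

/-- The Choi matrix of `L`, whose block `(i, j)` is `L E_{ij}`. -/
def choi {n : ℕ} (L : Mat n →ₗ[ℂ] Mat n) : BlockMat n :=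
  Matrix.of fun p q => L (Matrix.single p.1 q.1 1) p.2 q.2

/-- `F` is a face of `C`: a convex subset of `C` that contains both end points of every segment in
`C` having a relative interior point in `F`. -/
def IsFaceOf {E : Type*} [AddCommGroup E] [Module ℝ E] (C F : Set E) : Prop :=
  Convex ℝ F ∧ IsExtreme ℝ C F

/-- The face of `C` generated by `x`: the smallest face of `C` that contains `x`. -/
def generatedFace {E : Type*} [AddCommGroup E] [Module ℝ E] (C : Set E) (x : E) : Set E :=
  ⋂₀ {F : Set E | IsFaceOf C F ∧ x ∈ F}

/-- The (real, affine) dimension of a nonempty set in a finite-dimensional space. -/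
def setDim {E : Type*} [AddCommGroup E] [Module ℝ E] (S : Set E) : ℕ :=
  Module.finrank ℝ (vectorSpan ℝ S)

/-- The dimension of the face of the set of quantum channels generated by `L`. -/
def faceDim {n : ℕ} (L : Mat n →ₗ[ℂ] Mat n) : ℕ :=
  setDim (generatedFace (channels n) L)

/-- The block matrix `y yᴴ + z zᴴ` with `y = (e₁, 0, …, 0)` and `z = (0, e₁, e₂, …, eₙ₋₁)`. -/
def exampleZero (n : ℕ) : BlockMat n :=
  let y : Fin n × Fin n → ℂ := fun p => if p.1.val = 0 ∧ p.2.val = 0 then 1 else 0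
  let z : Fin n × Fin n → ℂ := fun p => if p.1.val = p.2.val + 1 then 1 else 0
  Matrix.vecMulVec y (star y) + Matrix.vecMulVec z (star z)

/-- Given `B` of block size `m`, the matrix of block size `m + 1` with entry `1` at the first
diagonal position, with `B` as the principal submatrix on the positions `(i, a)`, where neither `i`
nor `a` is the first index, and with all the other entries `0`. -/
def exampleTwo {m : ℕ} (B : BlockMat m) : BlockMat (m + 1) :=
  Matrix.single (0, 0) (0, 0) 1 +
    ∑ p, ∑ q, Matrix.single (Prod.map Fin.succ Fin.succ p) (Prod.map Fin.succ Fin.succ q) (B p q)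

/-- The real symmetric `3 × 3` matrix on which the example of dimension one is built. -/
def matP : Mat 3 :=
  (!![1, 9 / (4 * √6), 3 / (2 * √6);
      9 / (4 * √6), 1, 1 / 4;
      3 / (2 * √6), 1 / 4, 1] : Matrix (Fin 3) (Fin 3) ℝ).map Complex.ofReal

/-- The last index goes to `2`, the last but one to `1`, all the earlier ones to `0`. -/
def lastThree {n : ℕ} (i : Fin n) : Fin 3 :=
  if i.val + 1 = n then 2 else if i.val + 2 = n then 1 else 0

/-- The block matrix whose block `(i, j)` is `c_{ij} E_{ij}`, where `c` is obtained from `matP` by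
repeating its first row and column `n - 2` times. -/
def exampleOne (n : ℕ) : BlockMat n :=
  Matrix.of fun p q =>
    (matP (lastThree p.1) (lastThree q.1) • Matrix.single p.1 q.1 (1 : ℂ) : Mat n) p.2 q.2

end QuantumFaces

end

/-! Write `L` with linearly independent Kraus operators `A i`. The directions in which `L` can be
moved both ways inside the channels are the maps `krausMap A h`, with `h` Hermitian and `∑ h i j •
((A j)ᴴ * A i) = 0`. Positivity costs nothing near `h = 0`, because `1 ± ε h` stays positive
semidefinite; conversely, the Kraus operators of a nearby channel on a segment through `L` lie in
the span of the `A i`. So the face dimension is the real dimension of the space of such `h`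
(`faceDim_krausMap`).

For Choi rank two, suppose some such `h` is nonzero. Diagonalizing it by a unitary change of Kraus
operators `A`, `B` gives a relation between `Aᴴ * A` and `Bᴴ * B` which, combined with `Aᴴ * A + Bᴴ
* B = 1`, makes both of them positive scalars (`faceDim_eq_zero_or_exists_scalar`). What is left is
the condition that `z • R + conj z • Rᴴ` be scalar for `R = Bᴴ * A`, a multiple of a unitary; the
dimension is one plus that of the space of such `z` (`finrank_pairKernel_of_scalar`). If every `z`
qualified, `R` would be scalar and `A`, `B` dependent, so the total is 1 or 2. For `n = 2` a
suitable rotation of `R` always has scalar Hermitian part (`scalarPart_ne_bot_of_two`), which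
excludes 1. The examples are computed directly from the kernel equation. -/

noncomputable section

namespace QuantumFaces

/-! ### Faces generated by a point of a convex set -/

section GeneratedFace

variable {E : Type*} [AddCommGroup E] [Module ℝ E] {C : Set E} {x y : E}

theorem add_smul_mem_of_le (hC : Convex ℝ C) (hx : x ∈ C) {d : E} {s t : ℝ} (hs : 0 < s)
    (hst : s ≤ t) (h : x + t • d ∈ C) : x + s • d ∈ C := by
  have ht : 0 < t := hs.trans_le hst
  have := hC hx h (a := 1 - s / t) (b := s / t) (by rw [sub_nonneg, div_le_one ht]; exact hst)
    (by positivity) (by ring)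
  convert this using 1
  have hts : s / t * t = s := div_mul_cancel₀ s ht.ne'
  rw [smul_add, smul_smul, hts]
  module

/-- The face generated by `x` consists of the points `y` of `C` such that the segment from `y` to
`x` can be prolonged beyond `x` inside `C`. -/
theorem mem_generatedFace_iff (hC : Convex ℝ C) (hx : x ∈ C) :
    y ∈ generatedFace C x ↔ y ∈ C ∧ ∃ ε : ℝ, 0 < ε ∧ x + ε • (x - y) ∈ C := by
  constructor
  · intro h
    refine h {y | y ∈ C ∧ ∃ ε : ℝ, 0 < ε ∧ x + ε • (x - y) ∈ C} ⟨⟨?_, ?_, ?_⟩, ?_⟩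
    · rintro u ⟨hu, ε, hε, hu'⟩ v ⟨hv, δ, hδ, hv'⟩ a b ha hb hab
      refine ⟨hC hu hv ha hb hab, min ε δ, lt_min hε hδ, ?_⟩
      have h1 := add_smul_mem_of_le hC hx (lt_min hε hδ) (min_le_left _ _) hu'
      have h2 := add_smul_mem_of_le hC hx (lt_min hε hδ) (min_le_right _ _) hv'
      convert hC h1 h2 ha hb hab using 1
      obtain rfl : b = 1 - a := by linarith
      module
    · exact fun y hy => hy.1
    · rintro u hu v hv z ⟨-, ε, hε, hz⟩ ⟨a, b, ha, hb, hab, rfl⟩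
      -- Averaging the prolonged point `x + ε • (x - z)` with `v`, in weights proportional to `1`
      -- and `ε * b`, cancels the `v`-component of `z` and leaves a point beyond `x` on the line
      -- from `u`.
      refine ⟨hu, ε * a / (1 + ε * b), by positivity, ?_⟩
      have hpos : 0 < 1 + ε * b := by positivity
      convert hC hz hv (a := 1 / (1 + ε * b)) (b := ε * b / (1 + ε * b)) (by positivity)
        (by positivity) (by field_simp) using 1
      obtain rfl : a = 1 - b := by linarith
      match_scalars <;> field_simp <;> ring
    · exact ⟨hx, 1, one_pos, by simpa using hx⟩
  · rintro ⟨hy, ε, hε, h⟩ F ⟨⟨-, hF⟩, hxF⟩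
    refine hF.left_mem_of_mem_openSegment hy h hxF
      ⟨ε / (1 + ε), 1 / (1 + ε), by positivity, by positivity, by field_simp; ring, ?_⟩
    match_scalars <;> field_simp <;> ring

/-- A point `y` of the face can be prolonged through `x`, so `y - x` is a direction available both
ways; conversely `x + ε • d` lies in the face because its reflection `x - ε • d` is in `C`. -/
theorem vectorSpan_generatedFace (hC : Convex ℝ C) (hx : x ∈ C) (W : Submodule ℝ E)
    (hW : ∀ d, d ∈ W ↔ ∃ ε : ℝ, 0 < ε ∧ x + ε • d ∈ C ∧ x - ε • d ∈ C) :
    vectorSpan ℝ (generatedFace C x) = W := by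
  have hxF : x ∈ generatedFace C x :=
    (mem_generatedFace_iff hC hx).2 ⟨hx, 1, one_pos, by simpa using hx⟩
  apply le_antisymm
  · rw [vectorSpan_eq_span_vsub_set_right ℝ hxF, Submodule.span_le]
    rintro _ ⟨y, hy, rfl⟩
    obtain ⟨hyC, ε, hε, h⟩ := (mem_generatedFace_iff hC hx).1 hy
    refine (hW _).2 ⟨min ε 1, by positivity, ?_, ?_⟩
    · exact add_smul_mem_of_le hC hx (by positivity) (min_le_right _ _) (by simpa using hyC)
    · have := add_smul_mem_of_le hC hx (d := x - y) (s := min ε 1) (by positivity)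
        (min_le_left _ _) h
      convert this using 1
      simp only [vsub_eq_sub]
      module
  · intro d hd
    obtain ⟨ε, hε, h1, h2⟩ := (hW d).1 hd
    have hmem : x + ε • d ∈ generatedFace C x :=
      (mem_generatedFace_iff hC hx).2 ⟨h1, 1, one_pos, by convert h2 using 1; module⟩
    have := vsub_mem_vectorSpan ℝ hmem hxF
    rw [vsub_eq_sub, add_sub_cancel_left] at this
    exact (Submodule.smul_mem_iff _ hε.ne').1 this

end GeneratedFace

/-! ### Kraus representations and their coefficient matrices -/

section KrausMap

open Matrix

variable {n : ℕ} {ι κ : Type*} [Fintype ι] [Fintype κ]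

/-- The linear map `X ↦ ∑ i j, h i j • A i * X * (A j)ᴴ`, as a linear function of `h`. -/
def krausMap (A : ι → Mat n) : Matrix ι ι ℂ →ₗ[ℂ] (Mat n →ₗ[ℂ] Mat n) where
  toFun h := ∑ i, ∑ j, h i j • (LinearMap.mulLeft ℂ (A i) ∘ₗ LinearMap.mulRight ℂ (A j)ᴴ)
  map_add' g h := by simp only [Matrix.add_apply, add_smul, Finset.sum_add_distrib]
  map_smul' c h := by
    simp only [Matrix.smul_apply, smul_eq_mul, mul_smul, Finset.smul_sum, RingHom.id_apply]

theorem krausMap_apply (A : ι → Mat n) (h : Matrix ι ι ℂ) (X : Mat n) :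
    krausMap A h X = ∑ i, ∑ j, h i j • (A i * X * (A j)ᴴ) := by
  simp [krausMap, LinearMap.sum_apply, mul_assoc]

theorem krausMap_one_apply [DecidableEq ι] (A : ι → Mat n) (X : Mat n) :
    krausMap A 1 X = ∑ i, A i * X * (A i)ᴴ := by
  simp [krausMap_apply, Matrix.one_apply, ite_smul]

/-- The matrices `∑ i, U i l • A i`. -/
def recombine (A : ι → Mat n) (U : Matrix ι κ ℂ) : κ → Mat n := fun l => ∑ i, U i l • A i

/-- Changing the Kraus operators acts on coefficients by congruence. This covers unitary mixing, the
reduction of a positive semidefinite `g` to `1`, and the removal of redundant operators. -/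
theorem krausMap_recombine (A : ι → Mat n) (U : Matrix ι κ ℂ) (g : Matrix κ κ ℂ) :
    krausMap (recombine A U) g = krausMap A (U * g * Uᴴ) := by
  ext1 X
  have comm : ∀ f : ι → ι → κ → κ → Mat n,
      ∑ k, ∑ l, ∑ i, ∑ j, f i j l k = ∑ i, ∑ j, ∑ l, ∑ k, f i j l k := by
    intro f
    rw [Finset.sum_comm]
    simp only [fun l => Finset.sum_comm (s := (Finset.univ : Finset κ))
      (t := (Finset.univ : Finset ι)) (f := fun k i => ∑ j, f i j l k)]
    rw [Finset.sum_comm]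
    refine Finset.sum_congr rfl fun i _ => ?_
    simp only [fun l => Finset.sum_comm (s := (Finset.univ : Finset κ))
      (t := (Finset.univ : Finset ι)) (f := fun k j => f i j l k)]
    exact Finset.sum_comm
  simp only [krausMap_apply, recombine, Matrix.mul_apply, conjTranspose_sum, conjTranspose_smul,
    Finset.sum_mul, Finset.mul_sum, Finset.smul_sum, Finset.sum_smul, smul_mul_assoc,
    mul_smul_comm, smul_smul, conjTranspose_apply]
  rw [← comm]
  refine Finset.sum_congr rfl fun k _ => Finset.sum_congr rfl fun l _ => ?_
  rw [Finset.sum_comm]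
  refine Finset.sum_congr rfl fun i _ => Finset.sum_congr rfl fun j _ => ?_
  congr 1
  ring

theorem isCompletelyPositive_krausMap_one [DecidableEq ι] (A : ι → Mat n) :
    IsCompletelyPositive (krausMap A 1) := by
  refine ⟨Fintype.card ι, A ∘ (Fintype.equivFin ι).symm, fun X => ?_⟩
  rw [krausMap_one_apply, ← (Fintype.equivFin ι).symm.sum_comp]
  rfl

theorem IsCompletelyPositive.exists_krausMap {L : Mat n →ₗ[ℂ] Mat n}
    (h : IsCompletelyPositive L) : ∃ (k : ℕ) (K : Fin k → Mat n), L = krausMap K 1 := by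
  obtain ⟨k, K, hK⟩ := h
  exact ⟨k, K, LinearMap.ext fun X => by rw [hK, krausMap_one_apply]⟩

open scoped MatrixOrder Matrix.Norms.L2Operator in
theorem exists_eq_mul_conjTranspose [DecidableEq ι] {g : Matrix ι ι ℂ} (hg : g.PosSemidef) :
    ∃ C : Matrix ι ι ℂ, g = C * Cᴴ :=
  CStarAlgebra.nonneg_iff_eq_mul_star_self.mp hg.nonneg

open scoped MatrixOrder Matrix.Norms.L2Operator in
theorem exists_posSemidef_one_add_smul [DecidableEq ι] {h : Matrix ι ι ℂ} (hh : h.IsHermitian) :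
    ∃ ε : ℝ, 0 < ε ∧ (1 + ε • h).PosSemidef ∧ (1 - ε • h).PosSemidef := by
  have h1 := IsSelfAdjoint.le_algebraMap_norm_self (a := h) hh
  have h2 := IsSelfAdjoint.neg_algebraMap_norm_le_self (a := h) hh
  have hN : 0 ≤ ‖h‖ := norm_nonneg h
  have hone : (0 : Matrix ι ι ℂ) ≤ 1 := PosSemidef.one.nonneg
  rw [Algebra.algebraMap_eq_smul_one] at h1 h2
  -- The bounds `-‖h‖ ≤ h ≤ ‖h‖` suffice; the extra `1` in the denominator covers `h = 0`.
  refine ⟨1 / (‖h‖ + 1), by positivity, ?_, ?_⟩ <;> rw [← nonneg_iff_posSemidef]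
  · have : (1 : Matrix ι ι ℂ) + (1 / (‖h‖ + 1)) • h
        = (1 / (‖h‖ + 1)) • (1 + (h - -(‖h‖ • (1 : Matrix ι ι ℂ)))) := by
      match_scalars <;> grind
    rw [this]
    exact smul_nonneg (by positivity) (add_nonneg hone (sub_nonneg.2 h2))
  · have : (1 : Matrix ι ι ℂ) - (1 / (‖h‖ + 1)) • h
        = (1 / (‖h‖ + 1)) • (1 + (‖h‖ • (1 : Matrix ι ι ℂ) - h)) := by
      match_scalars <;> grind
    rw [this]
    exact smul_nonneg (by positivity) (add_nonneg hone (sub_nonneg.2 h1))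

theorem isCompletelyPositive_krausMap [DecidableEq ι] (A : ι → Mat n) {g : Matrix ι ι ℂ}
    (hg : g.PosSemidef) : IsCompletelyPositive (krausMap A g) := by
  obtain ⟨C, rfl⟩ := exists_eq_mul_conjTranspose hg
  have := krausMap_recombine A C 1
  rw [mul_one] at this
  rw [← this]
  exact isCompletelyPositive_krausMap_one _

theorem IsCompletelyPositive.add {L M : Mat n →ₗ[ℂ] Mat n} (hL : IsCompletelyPositive L)
    (hM : IsCompletelyPositive M) : IsCompletelyPositive (L + M) := by
  obtain ⟨k, K, rfl⟩ := hL.exists_krausMap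
  obtain ⟨l, J, rfl⟩ := hM.exists_krausMap
  convert isCompletelyPositive_krausMap_one (Sum.elim K J)
  ext1 X
  simp [krausMap_one_apply]

theorem IsCompletelyPositive.smul {L : Mat n →ₗ[ℂ] Mat n} (hL : IsCompletelyPositive L)
    {t : ℝ} (ht : 0 ≤ t) : IsCompletelyPositive (t • L) := by
  obtain ⟨k, K, rfl⟩ := hL.exists_krausMap
  convert isCompletelyPositive_krausMap K (PosSemidef.one.smul ht) using 1
  ext1 X
  rw [LinearMap.smul_apply, krausMap_one_apply, krausMap_apply]
  simp [Matrix.one_apply, Finset.smul_sum, ite_smul, Matrix.smul_apply]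

theorem convex_channels (n : ℕ) : Convex ℝ (channels n) := by
  rintro L ⟨hL, hL'⟩ M ⟨hM, hM'⟩ a b ha hb hab
  refine ⟨(hL.smul ha).add (hM.smul hb), fun X => ?_⟩
  rw [LinearMap.add_apply, LinearMap.smul_apply, LinearMap.smul_apply, trace_add, trace_smul,
    trace_smul, hL', hM', ← add_smul, hab, one_smul]

/-- The sesquilinear pairing of two functionals with the Choi matrix of a linear map. -/
def pairing (φ ψ : Mat n →ₗ[ℂ] ℂ) : (Mat n →ₗ[ℂ] Mat n) →ₗ[ℂ] ℂ where
  toFun L := ∑ i, ∑ j, ∑ a, ∑ b,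
    φ (single a i 1) * star (ψ (single b j 1)) * L (single i j 1) a b
  map_add' L M := by
    simp only [LinearMap.add_apply, Matrix.add_apply, mul_add, Finset.sum_add_distrib]
  map_smul' c L := by
    simp only [LinearMap.smul_apply, Matrix.smul_apply, smul_eq_mul, mul_left_comm _ c,
      Finset.mul_sum, RingHom.id_apply]

theorem functional_apply (φ : Mat n →ₗ[ℂ] ℂ) (X : Mat n) :
    φ X = ∑ i, ∑ a, φ (single a i 1) * X a i := by
  conv_lhs => rw [matrix_eq_sum_single X]
  rw [Finset.sum_comm]
  simp only [map_sum]
  refine Finset.sum_congr rfl fun i _ => Finset.sum_congr rfl fun a _ => ?_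
  rw [← mul_one (X a i), ← smul_eq_mul, ← smul_single, map_smul]
  simp [mul_comm]

theorem mul_single_mul_conjTranspose_apply (A B : Mat n) (i j a b : Fin n) :
    (A * single i j (1 : ℂ) * Bᴴ) a b = A a i * star (B b j) := by
  rw [mul_assoc, Matrix.mul_apply]
  simp [Matrix.mul_apply, single_apply, ite_and]

theorem pairing_mulLeft_comp_mulRight (φ ψ : Mat n →ₗ[ℂ] ℂ) (A B : Mat n) :
    pairing φ ψ (LinearMap.mulLeft ℂ A ∘ₗ LinearMap.mulRight ℂ Bᴴ) = φ A * star (ψ B) := by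
  rw [functional_apply φ A, functional_apply ψ B]
  simp only [star_sum, Finset.sum_mul_sum, star_mul', pairing, LinearMap.coe_mk, AddHom.coe_mk]
  refine Finset.sum_congr rfl fun (i : Fin n) _ => Finset.sum_congr rfl fun (j : Fin n) _ =>
    Finset.sum_congr rfl fun (a : Fin n) _ => Finset.sum_congr rfl fun (b : Fin n) _ => ?_
  rw [LinearMap.comp_apply, LinearMap.mulLeft_apply, LinearMap.mulRight_apply, ← mul_assoc,
    mul_single_mul_conjTranspose_apply]
  ring

theorem pairing_krausMap (φ ψ : Mat n →ₗ[ℂ] ℂ) (A : ι → Mat n) (h : Matrix ι ι ℂ) :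
    pairing φ ψ (krausMap A h) = ∑ k, ∑ l, h k l * (φ (A k) * star (ψ (A l))) := by
  simp [krausMap, pairing_mulLeft_comp_mulRight]

theorem pairing_self_krausMap_one [DecidableEq ι] (φ : Mat n →ₗ[ℂ] ℂ) (A : ι → Mat n) :
    pairing φ φ (krausMap A 1) = ((∑ k, Complex.normSq (φ (A k)) : ℝ) : ℂ) := by
  rw [pairing_krausMap]
  simp [Matrix.one_apply, Complex.mul_conj]

/-- Independence supplies functionals dual to the `A i`; pairing with the `k`-th and the `l`-th one
reads off `h k l`. -/
theorem krausMap_injective {A : ι → Mat n} (hA : LinearIndependent ℂ A) :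
    Function.Injective (krausMap A) := by
  classical
  rw [injective_iff_map_eq_zero]
  intro h hh
  obtain ⟨f, hf⟩ := LinearMap.exists_leftInverse_of_injective (Fintype.linearCombination ℂ A)
    (LinearMap.ker_eq_bot.2 (linearIndependent_iff_injective_fintypeLinearCombination.1 hA))
  have hfA : ∀ i j, f (A i) j = if j = i then 1 else 0 := by
    intro i j
    have := congrArg (fun g => g (Pi.single i 1) j) hf
    simpa [Fintype.linearCombination_apply_single, Pi.single_apply] using this
  ext k l
  have := pairing_krausMap (LinearMap.proj k ∘ₗ f) (LinearMap.proj l ∘ₗ f) A h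
  rw [hh] at this
  simpa [hfA] using this.symm

/-- The Kraus operators of one summand of a completely positive map are spanned by the Kraus
operators of the whole map. -/
theorem mem_span_of_krausMap_add_eq [DecidableEq ι] {μ : Type*} [Fintype μ] [DecidableEq κ]
    [DecidableEq μ] {A : ι → Mat n} {K : κ → Mat n} {J : μ → Mat n}
    {g : Matrix ι ι ℂ} (h : krausMap K 1 + krausMap J 1 = krausMap A g) (k : κ) :
    K k ∈ Submodule.span ℂ (Set.range A) := by
  by_contra hk
  -- A functional that kills the span but not `K k` turns the hypothesis into a vanishing sum of
  -- squares with a positive term.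
  obtain ⟨φ, hφk, hφ⟩ := Submodule.exists_le_ker_of_notMem hk
  have hφA : ∀ i, φ (A i) = 0 := fun i => hφ (Submodule.subset_span ⟨i, rfl⟩)
  have h1 := congrArg (pairing φ φ) h
  rw [map_add, pairing_self_krausMap_one, pairing_self_krausMap_one, pairing_krausMap] at h1
  simp only [hφA, zero_mul, mul_zero, Finset.sum_const_zero] at h1
  norm_cast at h1
  have h2 : 0 ≤ ∑ k, Complex.normSq (φ (J k)) :=
    Finset.sum_nonneg fun _ _ => Complex.normSq_nonneg _
  have h3 := Finset.single_le_sum (f := fun k => Complex.normSq (φ (K k)))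
    (fun _ _ => Complex.normSq_nonneg _) (Finset.mem_univ k)
  exact absurd (Complex.normSq_pos.2 hφk) (by linarith)

omit [Fintype κ] in
theorem exists_recombine_eq {A : ι → Mat n} {K : κ → Mat n}
    (h : ∀ k, K k ∈ Submodule.span ℂ (Set.range A)) :
    ∃ U : Matrix ι κ ℂ, recombine A U = K := by
  simp only [Submodule.mem_span_range_iff_exists_fun] at h
  choose c hc using h
  exact ⟨fun i k => c k i, funext hc⟩

end KrausMap

/-! ### Face dimension as the dimension of a kernel -/

section FaceKernel

open Matrix Module

variable {n : ℕ} {ι κ : Type*} [Fintype ι] [Fintype κ]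

/-- The Hermitian matrices `h` for which `krausMap A h` maps into the matrices of trace zero. -/
def faceKernel (A : ι → Mat n) : Submodule ℝ (Matrix ι ι ℂ) where
  carrier := {h | h.IsHermitian ∧ ∀ X, (krausMap A h X).trace = 0}
  zero_mem' := ⟨isHermitian_zero, fun X => by simp⟩
  add_mem' {g h} hg hh := ⟨hg.1.add hh.1, fun X => by
    rw [map_add, LinearMap.add_apply, trace_add, hg.2, hh.2, add_zero]⟩
  smul_mem' c h hh := by
    refine ⟨?_, fun X => ?_⟩
    · rw [IsHermitian, conjTranspose_smul, hh.1.eq, star_trivial]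
    · rw [← Complex.coe_smul, map_smul, LinearMap.smul_apply, trace_smul, hh.2, smul_zero]

theorem mem_faceKernel {A : ι → Mat n} {h : Matrix ι ι ℂ} :
    h ∈ faceKernel A ↔ h.IsHermitian ∧ ∀ X, (krausMap A h X).trace = 0 := Iff.rfl

/-- The dimension of the face generated by a channel with linearly independent Kraus operators. -/
theorem faceDim_krausMap [DecidableEq ι] {A : ι → Mat n} (hA : LinearIndependent ℂ A)
    (hL : krausMap A 1 ∈ channels n) : faceDim (krausMap A 1) = finrank ℝ (faceKernel A) := by
  let f := (krausMap A).restrictScalars ℝ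
  have hf : Function.Injective f := krausMap_injective hA
  have hspan := vectorSpan_generatedFace (convex_channels n) hL ((faceKernel A).map f) ?_
  · rw [faceDim, setDim, hspan]
    exact (Submodule.equivMapOfInjective f hf (faceKernel A)).finrank_eq.symm
  intro d
  constructor
  · rintro ⟨h, ⟨hh, htr⟩, rfl⟩
    obtain ⟨ε, hε, h1, h2⟩ := exists_posSemidef_one_add_smul hh
    have e1 : krausMap A 1 + ε • f h = krausMap A (1 + ε • h) := by
      change f 1 + ε • f h = f (1 + ε • h)
      rw [map_add, map_smul]
    have e2 : krausMap A 1 - ε • f h = krausMap A (1 - ε • h) := by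
      change f 1 - ε • f h = f (1 - ε • h)
      rw [map_sub, map_smul]
    have htr' : ∀ X, (f h X).trace = 0 := htr
    refine ⟨ε, hε, ⟨e1 ▸ isCompletelyPositive_krausMap A h1, fun X => ?_⟩,
      ⟨e2 ▸ isCompletelyPositive_krausMap A h2, fun X => ?_⟩⟩
    · rw [LinearMap.add_apply, LinearMap.smul_apply, trace_add, trace_smul, htr', hL.2, smul_zero,
        add_zero]
    · rw [LinearMap.sub_apply, LinearMap.smul_apply, trace_sub, trace_smul, htr', hL.2, smul_zero,
        sub_zero]
  · rintro ⟨ε, hε, h1, h2⟩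
    obtain ⟨k, K, hK⟩ := h1.1.exists_krausMap
    obtain ⟨l, J, hJ⟩ := h2.1.exists_krausMap
    -- The two ends `L + ε • d` and `L - ε • d` add up to `2 L`, so the Kraus operators of each end
    -- lie in the span of `A`.
    have hsum : krausMap K 1 + krausMap J 1 = krausMap A (1 + 1) := by
      rw [← hK, ← hJ, map_add]
      abel
    obtain ⟨U, rfl⟩ := exists_recombine_eq (mem_span_of_krausMap_add_eq hsum)
    rw [krausMap_recombine, Matrix.mul_one] at hK
    have hd : d = f (ε⁻¹ • (U * Uᴴ - 1)) := by
      rw [map_smul, map_sub]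
      change d = ε⁻¹ • (krausMap A (U * Uᴴ) - krausMap A 1)
      rw [← hK, add_sub_cancel_left, smul_smul, inv_mul_cancel₀ hε.ne', one_smul]
    refine ⟨_, ⟨?_, fun X => ?_⟩, hd.symm⟩
    · rw [IsHermitian, conjTranspose_smul, star_trivial,
        ((isHermitian_mul_conjTranspose_self U).sub isHermitian_one).eq]
    · change (f (ε⁻¹ • (U * Uᴴ - 1)) X).trace = 0
      rw [← hd]
      have h3 := h1.2 X
      rw [LinearMap.add_apply, LinearMap.smul_apply, trace_add, trace_smul, hL.2, add_eq_left,
        smul_eq_zero] at h3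
      exact h3.resolve_left hε.ne'

theorem choi_krausMap_one_apply [DecidableEq ι] (A : ι → Mat n) (p q : Fin n × Fin n) :
    choi (krausMap A 1) p q = ∑ k, A k p.2 p.1 * star (A k q.2 q.1) := by
  simp [choi, krausMap_one_apply, Matrix.sum_apply, mul_single_mul_conjTranspose_apply]

/-- The Choi matrix is `V * Vᴴ`, where the columns of `V` are the vectorized Kraus operators, and `V
* Vᴴ` has the rank of `V`. -/
theorem rank_choi_krausMap_one [DecidableEq ι] (A : ι → Mat n) :
    (choi (krausMap A 1)).rank = finrank ℂ (Submodule.span ℂ (Set.range A)) := by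
  let v : Mat n →ₗ[ℂ] (Fin n × Fin n → ℂ) :=
    { toFun := Matrix.vec, map_add' := fun _ _ => rfl, map_smul' := fun _ _ => rfl }
  have hv : Function.Injective v := Matrix.vec_bijective.injective
  let V : Matrix (Fin n × Fin n) ι ℂ := Matrix.of fun p k => v (A k) p
  have hV : choi (krausMap A 1) = V * Vᴴ := by
    ext p q
    rw [choi_krausMap_one_apply, Matrix.mul_apply]
    rfl
  have hcol : Set.range V.col = v '' Set.range A := by
    rw [← Set.range_comp]
    rfl
  rw [hV, rank_self_mul_conjTranspose, rank_eq_finrank_span_cols, hcol, ← Submodule.map_span]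
  exact (Submodule.equivMapOfInjective v hv _).finrank_eq.symm

theorem linearIndependent_iff_rank_choi [DecidableEq ι] (A : ι → Mat n) :
    LinearIndependent ℂ A ↔ (choi (krausMap A 1)).rank = Fintype.card ι := by
  rw [rank_choi_krausMap_one, linearIndependent_iff_card_eq_finrank_span, eq_comm]
  rfl

theorem exists_linearIndependent_krausMap {L : Mat n →ₗ[ℂ] Mat n} (hL : IsCompletelyPositive L)
    {k : ℕ} (hk : (choi L).rank = k) :
    ∃ A : Fin k → Mat n, LinearIndependent ℂ A ∧ L = krausMap A 1 := by
  obtain ⟨l, K, rfl⟩ := hL.exists_krausMap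
  let b := finBasisOfFinrankEq ℂ _ ((rank_choi_krausMap_one K).symm.trans hk)
  let A : Fin k → Mat n := fun i => b i
  have hA : ∀ j, K j ∈ Submodule.span ℂ (Set.range A) := by
    intro j
    have h := b.mem_span ⟨K j, Submodule.subset_span ⟨j, rfl⟩⟩
    have := Submodule.mem_map_of_mem (f := Submodule.subtype _) h
    rwa [Submodule.map_span, ← Set.range_comp] at this
  obtain ⟨U, hU⟩ := exists_recombine_eq hA
  -- Only `U * Uᴴ` matters, so the `k × l` matrix `U` can be traded for a square `C`. This leaves
  -- exactly `k` Kraus operators, which the rank forces to be independent.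
  obtain ⟨C, hC⟩ := exists_eq_mul_conjTranspose (posSemidef_self_mul_conjTranspose U)
  have h : krausMap K 1 = krausMap (recombine A C) 1 := by
    rw [← hU, krausMap_recombine, krausMap_recombine, Matrix.mul_one, Matrix.mul_one, hC]
  refine ⟨recombine A C, ?_, h⟩
  rw [linearIndependent_iff_rank_choi, ← h, hk, Fintype.card_fin]

theorem trace_krausMap (A : ι → Mat n) (h : Matrix ι ι ℂ) (X : Mat n) :
    (krausMap A h X).trace = ((∑ i, ∑ j, h i j • ((A j)ᴴ * A i)) * X).trace := by
  simp only [krausMap_apply, trace_sum, Finset.sum_mul, trace_smul, smul_mul_assoc]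
  refine Finset.sum_congr rfl fun i _ => Finset.sum_congr rfl fun j _ => ?_
  rw [trace_mul_comm, mul_assoc]

theorem mem_faceKernel_iff {A : ι → Mat n} {h : Matrix ι ι ℂ} :
    h ∈ faceKernel A ↔ h.IsHermitian ∧ ∑ i, ∑ j, h i j • ((A j)ᴴ * A i) = 0 := by
  rw [mem_faceKernel, ext_iff_trace_mul_right]
  simp [trace_krausMap]

theorem krausMap_one_mem_channels_iff [DecidableEq ι] {A : ι → Mat n} :
    krausMap A 1 ∈ channels n ↔ ∑ i, (A i)ᴴ * A i = 1 := by
  rw [ext_iff_trace_mul_right]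
  simp [channels, isCompletelyPositive_krausMap_one, trace_krausMap, Matrix.one_apply]

/-- A nonzero element of `faceKernel A` becomes diagonal for a suitable choice of the Kraus
operators. -/
theorem exists_recombine_diagonal [DecidableEq ι] {A : ι → Mat n} {h : Matrix ι ι ℂ}
    (hh : h ∈ faceKernel A) (h0 : h ≠ 0) :
    ∃ (U : Matrix ι ι ℂ) (d : ι → ℝ), krausMap (recombine A U) 1 = krausMap A 1 ∧ d ≠ 0 ∧
      diagonal (fun i => (d i : ℂ)) ∈ faceKernel (recombine A U) := by
  have hs := hh.1.spectral_theorem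
  let U : Matrix ι ι ℂ := (hh.1.eigenvectorUnitary : Matrix ι ι ℂ)
  let d := hh.1.eigenvalues
  rw [Unitary.conjStarAlgAut_apply] at hs
  have hs' : h = U * diagonal (fun i => (d i : ℂ)) * Uᴴ := hs
  refine ⟨U, d, ?_, ?_, ?_, fun X => ?_⟩
  · rw [krausMap_recombine, mul_one]
    congr 1
    exact Unitary.coe_mul_star_self hh.1.eigenvectorUnitary
  · intro hd
    exact h0 (hh.1.eigenvalues_eq_zero_iff.1 hd)
  · exact isHermitian_diagonal_of_self_adjoint _ (by ext; simp)
  · rw [krausMap_recombine, ← hs', hh.2]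

end FaceKernel

/-! ### Channels of Choi rank two -/

section TwoKrausOperators

open Matrix Module ComplexConjugate

variable {n : ℕ}

/-- The coordinates of the Hermitian matrices in `faceKernel ![A, B]`. -/
def pairKernel (A B : Mat n) : Submodule ℝ (ℝ × ℝ × ℂ) where
  carrier := {v | (v.1 : ℂ) • (Aᴴ * A) + (v.2.1 : ℂ) • (Bᴴ * B) + v.2.2 • (Bᴴ * A)
    + conj v.2.2 • (Aᴴ * B) = 0}
  zero_mem' := by simp
  add_mem' {v w} hv hw := by
    rw [Set.mem_ofPred_eq] at *
    simp only [Prod.fst_add, Prod.snd_add, Complex.ofReal_add, map_add, add_smul]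
    rw [← add_zero (0 : Mat n)]
    nth_rw 1 [← hv]
    rw [← hw]
    abel
  smul_mem' c v hv := by
    rw [Set.mem_ofPred_eq] at *
    simp only [Prod.smul_fst, Prod.smul_snd, smul_eq_mul, Complex.ofReal_mul, Complex.real_smul,
      map_mul, Complex.conj_ofReal, mul_smul, ← smul_add, hv, smul_zero]

theorem mem_pairKernel {A B : Mat n} {a b : ℝ} {z : ℂ} :
    (a, b, z) ∈ pairKernel A B ↔ (a : ℂ) • (Aᴴ * A) + (b : ℂ) • (Bᴴ * B) + z • (Bᴴ * A)
      + conj z • (Aᴴ * B) = 0 := Iff.rfl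

/-- The Hermitian `2 × 2` matrix with given diagonal and upper right entry. -/
def hermitianOfCoords : ℝ × ℝ × ℂ →ₗ[ℝ] Matrix (Fin 2) (Fin 2) ℂ where
  toFun v := !![(v.1 : ℂ), v.2.2; conj v.2.2, (v.2.1 : ℂ)]
  map_add' v w := by ext i j; fin_cases i <;> fin_cases j <;> simp
  map_smul' c v := by ext i j; fin_cases i <;> fin_cases j <;> simp

theorem hermitianOfCoords_injective : Function.Injective hermitianOfCoords := by
  rintro ⟨a, b, z⟩ ⟨a', b', z'⟩ h
  have h1 := congrFun (congrFun h 0) 0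
  have h2 := congrFun (congrFun h 1) 1
  have h3 := congrFun (congrFun h 0) 1
  simp [hermitianOfCoords] at h1 h2 h3
  simp [h1, h2, h3]

theorem faceKernel_eq_map (A B : Mat n) :
    faceKernel ![A, B] = (pairKernel A B).map hermitianOfCoords := by
  ext h
  rw [mem_faceKernel_iff, Submodule.mem_map]
  constructor
  · rintro ⟨hh, h0⟩
    have h00 := hh.apply 0 0
    have h11 := hh.apply 1 1
    have h01 := hh.apply 1 0
    have e0 : ((h 0 0).re : ℂ) = h 0 0 := Complex.conj_eq_iff_re.1 h00
    have e1 : ((h 1 1).re : ℂ) = h 1 1 := Complex.conj_eq_iff_re.1 h11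
    have e2 : conj (h 0 1) = h 1 0 := h01
    refine ⟨((h 0 0).re, (h 1 1).re, h 0 1), ?_, ?_⟩
    · rw [mem_pairKernel, e0, e1, e2]
      simp only [Fin.sum_univ_two, cons_val_zero, cons_val_one] at h0
      rw [← h0]
      abel
    · ext i j
      fin_cases i <;> fin_cases j <;> simp [hermitianOfCoords, e0, e1, e2]
  · rintro ⟨⟨a, b, z⟩, hv, rfl⟩
    rw [mem_pairKernel] at hv
    constructor
    · ext i j
      fin_cases i <;> fin_cases j <;> simp [hermitianOfCoords]
    · simp only [Fin.sum_univ_two, cons_val_zero, cons_val_one, hermitianOfCoords, of_apply,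
        LinearMap.coe_mk, AddHom.coe_mk]
      rw [← hv]
      abel

theorem faceDim_pair {A B : Mat n} (h : LinearIndependent ℂ ![A, B])
    (hL : krausMap ![A, B] 1 ∈ channels n) :
    faceDim (krausMap ![A, B] 1) = finrank ℝ (pairKernel A B) := by
  rw [faceDim_krausMap h hL, faceKernel_eq_map]
  exact (Submodule.equivMapOfInjective _ hermitianOfCoords_injective _).finrank_eq.symm

/-- The complex numbers `z` for which the Hermitian part of `z • R` is a scalar matrix. -/
def scalarPart (R : Mat n) : Submodule ℝ ℂ where
  carrier := {z | ∃ c : ℝ, z • R + conj z • Rᴴ = (c : ℂ) • (1 : Mat n)}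
  zero_mem' := ⟨0, by simp⟩
  add_mem' := by
    rintro z w ⟨c, hc⟩ ⟨d, hd⟩
    refine ⟨c + d, ?_⟩
    rw [Complex.ofReal_add, add_smul (c : ℂ), ← hc, ← hd, map_add, add_smul, add_smul]
    abel
  smul_mem' := by
    rintro t z ⟨c, hc⟩
    refine ⟨t * c, ?_⟩
    rw [Complex.ofReal_mul, mul_smul, ← hc, Complex.real_smul, map_mul, Complex.conj_ofReal,
      mul_smul, mul_smul, smul_add]

theorem mem_scalarPart {R : Mat n} {z : ℂ} :
    z ∈ scalarPart R ↔ ∃ c : ℝ, z • R + conj z • Rᴴ = (c : ℂ) • (1 : Mat n) := Iff.rfl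

/-- The kernel equation only asks that `z • (Bᴴ * A)` have Hermitian part equal to a scalar fixed by
`a * p + b * q`. Hence `a` is free, `z` ranges over `scalarPart`, and `b` is then determined because
`q ≠ 0`. -/
theorem finrank_pairKernel_of_scalar [NeZero n] {A B : Mat n} {p q : ℝ} (hq : q ≠ 0)
    (hA : Aᴴ * A = (p : ℂ) • (1 : Mat n)) (hB : Bᴴ * B = (q : ℂ) • (1 : Mat n)) :
    finrank ℝ (pairKernel A B) = 1 + finrank ℝ (scalarPart (Bᴴ * A)) := by
  have key : ∀ {a b : ℝ} {z : ℂ}, (a, b, z) ∈ pairKernel A B ↔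
      z • (Bᴴ * A) + conj z • (Bᴴ * A)ᴴ = ((-(a * p + b * q) : ℝ) : ℂ) • (1 : Mat n) := by
    intro a b z
    rw [mem_pairKernel, hA, hB, conjTranspose_mul, conjTranspose_conjTranspose, smul_smul,
      smul_smul, ← add_smul, add_assoc, ← eq_neg_iff_add_eq_zero, eq_comm,
      neg_eq_iff_eq_neg, ← neg_smul]
    push_cast
    rfl
  let f : pairKernel A B →ₗ[ℝ] ℝ × scalarPart (Bᴴ * A) :=
    LinearMap.prod (LinearMap.fst ℝ ℝ (ℝ × ℂ) ∘ₗ (pairKernel A B).subtype)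
      (LinearMap.codRestrict _ (LinearMap.snd ℝ ℝ ℂ ∘ₗ LinearMap.snd ℝ ℝ (ℝ × ℂ) ∘ₗ
        (pairKernel A B).subtype) fun v => ⟨_, key.1 v.2⟩)
  have hf : Function.Bijective f := by
    constructor
    · rintro ⟨⟨a, b, z⟩, hv⟩ ⟨⟨a', b', z'⟩, hw⟩ h
      obtain rfl : a = a' := congrArg Prod.fst h
      obtain rfl : z = z' := congrArg (fun x => (x.2 : ℂ)) h
      have := congrFun (congrFun ((key.1 hv).symm.trans (key.1 hw)) 0) 0
      simp only [Matrix.smul_apply, one_apply_eq, smul_eq_mul, mul_one, Complex.ofReal_inj] at this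
      obtain rfl : b = b' := mul_right_cancel₀ hq (by linarith)
      rfl
    · rintro ⟨a, z, c, hc⟩
      refine ⟨⟨(a, -(a * p + c) / q, z), key.2 ?_⟩, rfl⟩
      rw [hc]
      congr 2
      field_simp
      ring
  rw [(LinearEquiv.ofBijective f hf).finrank_eq, finrank_prod, finrank_self]

theorem exists_eq_smul_one_of_scalarPart_eq_top {R : Mat n} (h : scalarPart R = ⊤) :
    ∃ c : ℂ, R = c • (1 : Mat n) := by
  obtain ⟨a, ha⟩ := mem_scalarPart.1 (h ▸ Submodule.mem_top : (1 : ℂ) ∈ scalarPart R)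
  obtain ⟨b, hb⟩ := mem_scalarPart.1 (h ▸ Submodule.mem_top : Complex.I ∈ scalarPart R)
  refine ⟨(a - Complex.I * b) / 2, ?_⟩
  rw [map_one, one_smul, one_smul] at ha
  rw [Complex.conj_I] at hb
  have : (2 : ℂ) • R = (a - Complex.I * b) • (1 : Mat n) := by
    rw [sub_smul, mul_smul, ← ha, ← hb, smul_add, smul_smul, smul_smul]
    simp only [mul_neg, Complex.I_mul_I]
    module
  rw [div_eq_inv_mul, mul_smul, ← this, smul_smul]
  norm_num

/-- With `s ^ 2 = det R`, the matrix `conj s • R` has positive determinant and is a multiple of a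
unitary, so its eigenvalues are conjugate to each other. Algebraically, `s • Rᴴ = conj s •
R.adjugate`, and `R + R.adjugate` is the trace of `R` times `1` in size two. -/
theorem scalarPart_ne_bot_of_two {R : Mat 2} {r : ℝ} (hr : 0 < r)
    (hR : R * Rᴴ = (r : ℂ) • (1 : Mat 2)) : scalarPart R ≠ ⊥ := by
  obtain ⟨s, hs⟩ := IsAlgClosed.exists_pow_nat_eq R.det (n := 2) (by norm_num)
  have hss : s * conj s = r := by
    have h := congrArg Matrix.det hR
    rw [det_mul, det_conjTranspose, det_smul, det_one, Fintype.card_fin, mul_one, ← hs,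
      ← starRingEnd_apply, map_pow, ← mul_pow, Complex.mul_conj, ← Complex.ofReal_pow,
      ← Complex.ofReal_pow, Complex.ofReal_inj, sq_eq_sq₀ (Complex.normSq_nonneg s) hr.le] at h
    rw [Complex.mul_conj, h]
  have hs0 : s ≠ 0 := by
    rintro rfl
    rw [zero_mul] at hss
    exact hr.ne (by exact_mod_cast hss)
  have hadj : (s ^ 2) • Rᴴ = (s * conj s) • R.adjugate := by
    have h := congrArg (R.adjugate * ·) hR
    simp only [← mul_assoc, adjugate_mul, smul_mul_assoc, one_mul, mul_smul_comm, mul_one] at h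
    rw [hs, hss, h]
  rw [sq, mul_smul, mul_smul, smul_right_inj hs0, adjugate_fin_two] at hadj
  have h00 : s * conj (R 0 0) = conj s * R 1 1 := by simpa using congrFun (congrFun hadj 0) 0
  have h01 : s * conj (R 1 0) = -(conj s * R 0 1) := by simpa using congrFun (congrFun hadj 0) 1
  have h10 : s * conj (R 0 1) = -(conj s * R 1 0) := by simpa using congrFun (congrFun hadj 1) 0
  have h11 : s * conj (R 1 1) = conj s * R 0 0 := by simpa using congrFun (congrFun hadj 1) 1
  rw [Submodule.ne_bot_iff]
  refine ⟨conj s, ⟨2 * (conj s * R 0 0).re, ?_⟩, (map_ne_zero _).2 hs0⟩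
  have hre : conj s * R 0 0 + s * conj (R 0 0) = 2 * ((conj s * R 0 0).re : ℂ) := by
    rw [← Complex.ofReal_ofNat, ← Complex.ofReal_mul, ← Complex.add_conj, map_mul,
      Complex.conj_conj]
  ext i j
  fin_cases i <;> fin_cases j
  · simpa using hre
  · simp [h01]
  · simp [h10]
  · simpa [h11, h00, add_comm] using hre

theorem eq_smul_of_conjTranspose_mul_eq_smul_one {A B : Mat n} {q : ℝ} {c : ℂ} (hq : q ≠ 0)
    (hB : Bᴴ * B = (q : ℂ) • (1 : Mat n)) (h : Bᴴ * A = c • (1 : Mat n)) :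
    A = (c / q) • B := by
  have hq' : (q : ℂ) ≠ 0 := by exact_mod_cast hq
  have h1 : ((q : ℂ)⁻¹ • Bᴴ) * B = 1 := by
    rw [smul_mul_assoc, hB, smul_smul, inv_mul_cancel₀ hq', one_smul]
  have h2 := mul_eq_one_comm.1 h1
  calc A = B * ((q : ℂ)⁻¹ • Bᴴ) * A := by rw [h2, one_mul]
    _ = (c / q) • B := by
      rw [mul_assoc, smul_mul_assoc, h, smul_smul, mul_smul_comm, mul_one, div_eq_inv_mul]

/-- A channel of Choi rank two whose face is not a point has Kraus operators that are multiples of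
unitary matrices. -/
theorem faceDim_eq_zero_or_exists_scalar [NeZero n] {L : Mat n →ₗ[ℂ] Mat n} (hL : L ∈ channels n)
    (hr : (choi L).rank = 2) : faceDim L = 0 ∨ ∃ (A B : Mat n) (p q : ℝ), 0 < p ∧ 0 < q ∧
      Aᴴ * A = (p : ℂ) • (1 : Mat n) ∧ Bᴴ * B = (q : ℂ) • (1 : Mat n) ∧
      LinearIndependent ℂ ![A, B] ∧ L = krausMap ![A, B] 1 := by
  obtain ⟨K, hK, rfl⟩ := exists_linearIndependent_krausMap hL.1 hr
  by_cases hbot : faceKernel K = ⊥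
  · left
    rw [faceDim_krausMap hK hL, hbot, finrank_bot]
  right
  obtain ⟨h, hh, h0⟩ := Submodule.exists_mem_ne_zero_of_ne_bot hbot
  obtain ⟨U, d, hU, hd0, hd⟩ := exists_recombine_diagonal hh h0
  rw [← hU] at hL hr ⊢
  clear hU
  generalize recombine K U = J at hL hr hd ⊢
  have hJ : LinearIndependent ℂ J := (linearIndependent_iff_rank_choi J).2 (by simpa using hr)
  have hsum := krausMap_one_mem_channels_iff.1 hL
  have hker := (mem_faceKernel_iff.1 hd).2
  simp only [Fin.sum_univ_two, diagonal_apply_eq, ne_eq, Fin.isValue, zero_ne_one, one_ne_zero,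
    not_false_eq_true, diagonal_apply_ne, zero_smul, add_zero, zero_add] at hsum hker
  have hone : (1 : Mat n) ≠ 0 := one_ne_zero
  -- Equal eigenvalues would turn the kernel relation into `d 0 • 1 = 0`. Once they differ, this
  -- relation and trace preservation form a solvable linear system for `(J 0)ᴴ * J 0` and `(J 1)ᴴ *
  -- J 1`.
  have hne : (d 0 : ℂ) - d 1 ≠ 0 := by
    intro heq
    have heq' : (d 0 : ℂ) = d 1 := sub_eq_zero.1 heq
    rw [heq', ← smul_add, hsum, smul_eq_zero] at hker
    have h1 := hker.resolve_right hone
    apply hd0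
    ext i
    fin_cases i
    · simpa [h1] using heq'
    · simpa using h1
  have hA : (J 0)ᴴ * J 0 = ((-d 1 / (d 0 - d 1) : ℝ) : ℂ) • (1 : Mat n) := by
    push_cast
    rw [div_eq_inv_mul, mul_smul, eq_inv_smul_iff₀ hne, sub_smul, eq_neg_of_add_eq_zero_left hker,
      ← hsum]
    module
  have hB : (J 1)ᴴ * J 1 = ((d 0 / (d 0 - d 1) : ℝ) : ℂ) • (1 : Mat n) := by
    rw [eq_sub_of_add_eq' hsum, hA]
    push_cast
    nth_rw 1 [← one_smul ℂ (1 : Mat n)]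
    rw [← sub_smul]
    congr 1
    field_simp
    ring
  have hpos : ∀ (i : Fin 2) (p : ℝ), (J i)ᴴ * J i = (p : ℂ) • (1 : Mat n) → 0 < p := by
    intro i p hp
    have hnonneg := (posSemidef_conjTranspose_mul_self (J i)).diag_nonneg (i := (0 : Fin n))
    rw [hp, Matrix.smul_apply, one_apply_eq, smul_eq_mul, mul_one] at hnonneg
    refine lt_of_le_of_ne (by exact_mod_cast hnonneg) ?_
    rintro rfl
    rw [Complex.ofReal_zero, zero_smul, conjTranspose_mul_self_eq_zero] at hp
    exact hJ.ne_zero i hp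
  have hJeq : J = ![J 0, J 1] := by ext1 i; fin_cases i <;> rfl
  exact ⟨J 0, J 1, _, _, hpos 0 _ hA, hpos 1 _ hB, hA, hB, hJeq ▸ hJ, congrArg (krausMap · 1) hJeq⟩

theorem finrank_scalarPart_le_one [NeZero n] {A B : Mat n} {q : ℝ} (hq : q ≠ 0)
    (hB : Bᴴ * B = (q : ℂ) • (1 : Mat n)) (h : LinearIndependent ℂ ![A, B]) :
    finrank ℝ (scalarPart (Bᴴ * A)) ≤ 1 := by
  by_contra! hlt
  have htop : scalarPart (Bᴴ * A) = ⊤ := by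
    apply Submodule.eq_top_of_finrank_eq
    have := Submodule.finrank_le (scalarPart (Bᴴ * A))
    rw [Complex.finrank_real_complex] at *
    omega
  obtain ⟨c, hc⟩ := exists_eq_smul_one_of_scalarPart_eq_top htop
  have := eq_smul_of_conjTranspose_mul_eq_smul_one hq hB hc
  have h2 := (LinearIndependent.pair_iff.1 h) 1 (-(c / q)) (by rw [one_smul, this]; module)
  exact one_ne_zero h2.1

theorem faceDim_le_two [NeZero n] {L : Mat n →ₗ[ℂ] Mat n} (hL : L ∈ channels n)
    (hr : (choi L).rank = 2) : faceDim L ≤ 2 := by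
  obtain h | ⟨A, B, p, q, hp, hq, hA, hB, hAB, rfl⟩ := faceDim_eq_zero_or_exists_scalar hL hr
  · omega
  · rw [faceDim_pair hAB hL, finrank_pairKernel_of_scalar hq.ne' hA hB]
    have := finrank_scalarPart_le_one hq.ne' hB hAB
    omega

theorem faceDim_two {L : Mat 2 →ₗ[ℂ] Mat 2} (hL : L ∈ channels 2)
    (hr : (choi L).rank = 2) : faceDim L = 0 ∨ faceDim L = 2 := by
  obtain h | ⟨A, B, p, q, hp, hq, hA, hB, hAB, rfl⟩ := faceDim_eq_zero_or_exists_scalar hL hr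
  · exact Or.inl h
  · right
    rw [faceDim_pair hAB hL, finrank_pairKernel_of_scalar hq.ne' hA hB]
    have h1 := finrank_scalarPart_le_one hq.ne' hB hAB
    have hR : (Bᴴ * A) * (Bᴴ * A)ᴴ = ((p * q : ℝ) : ℂ) • (1 : Mat 2) := by
      have hA' : A * Aᴴ = (p : ℂ) • (1 : Mat 2) := by
        have hp' : (p : ℂ) ≠ 0 := by exact_mod_cast hp.ne'
        have : ((p : ℂ)⁻¹ • Aᴴ) * A = 1 := by
          rw [smul_mul_assoc, hA, smul_smul, inv_mul_cancel₀ hp', one_smul]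
        rw [mul_eq_one_comm, mul_smul_comm, inv_smul_eq_iff₀ hp'] at this
        exact this
      rw [conjTranspose_mul, conjTranspose_conjTranspose, mul_assoc, ← mul_assoc A, hA',
        smul_mul_assoc, one_mul, mul_smul_comm, hB, smul_smul, Complex.ofReal_mul]
    have h2 := scalarPart_ne_bot_of_two (by positivity) hR
    have h3 : finrank ℝ (scalarPart (Bᴴ * A)) ≠ 0 := by rwa [ne_eq, Submodule.finrank_eq_zero]
    omega

end TwoKrausOperators

/-! ### Examples of each dimension -/

section Examples

open Matrix Module ComplexConjugate

variable {n : ℕ}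

theorem krausMap_pair_mem_channels {A B : Mat n} (h : Aᴴ * A + Bᴴ * B = 1) :
    krausMap ![A, B] 1 ∈ channels n :=
  krausMap_one_mem_channels_iff.2 (by simpa [Fin.sum_univ_two] using h)

theorem choi_krausMap_pair_apply (A B : Mat n) (p q : Fin n × Fin n) :
    choi (krausMap ![A, B] 1) p q
      = A p.2 p.1 * conj (A q.2 q.1) + B p.2 p.1 * conj (B q.2 q.1) := by
  rw [choi_krausMap_one_apply, Fin.sum_univ_two]
  rfl

/-- Assembles a channel with prescribed Choi matrix and face dimension from two Kraus operators. -/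
theorem exists_channel_of_pair {A B : Mat n} {Z : BlockMat n} {d : ℕ}
    (hZ : ∀ p q, A p.2 p.1 * conj (A q.2 q.1) + B p.2 p.1 * conj (B q.2 q.1) = Z p q)
    (h1 : Aᴴ * A + Bᴴ * B = 1) (h2 : ∀ s t : ℂ, s • A + t • B = 0 → s = 0 ∧ t = 0)
    (h3 : finrank ℝ (pairKernel A B) = d) :
    ∃ L ∈ channels n, choi L = Z ∧ (choi L).rank = 2 ∧ faceDim L = d := by
  have hL := krausMap_pair_mem_channels h1
  have hAB := LinearIndependent.pair_iff.2 h2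
  refine ⟨krausMap ![A, B] 1, hL, ?_, ?_, (faceDim_pair hAB hL).trans h3⟩
  · ext p q
    rw [choi_krausMap_pair_apply, hZ]
  · simpa using (linearIndependent_iff_rank_choi _).1 hAB

/-- The Kraus operators are a matrix unit and a shift. The products `Aᴴ * A`, `Bᴴ * B`, `Bᴴ * A`,
`Aᴴ * B` are nonzero with disjoint supports, so the kernel equation has only the zero solution. -/
theorem exampleZero_spec (hn : 2 ≤ n) : ∃ L ∈ channels n,
    choi L = exampleZero n ∧ (choi L).rank = 2 ∧ faceDim L = 0 := by
  let A : Mat n := Matrix.of fun a i => if i.val = 0 ∧ a.val = 0 then 1 else 0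
  let B : Mat n := Matrix.of fun a i => if i.val = a.val + 1 then 1 else 0
  let i₀ : Fin n := ⟨0, by omega⟩
  let i₁ : Fin n := ⟨1, by omega⟩
  have hAA : ∀ i j, (Aᴴ * A) i j = if i.val = 0 ∧ j.val = 0 then 1 else 0 := by
    intro i j
    rw [Matrix.mul_apply, Finset.sum_eq_single i₀ _ (by simp)]
    · simp [A, i₀, ← ite_and, and_comm]
    · intro b _ hb
      have : b.val ≠ 0 := fun h => hb (Fin.ext h)
      simp [A, this]
  have hBB : ∀ i j, (Bᴴ * B) i j = if i = j ∧ i.val ≠ 0 then 1 else 0 := by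
    intro i j
    rw [Matrix.mul_apply]
    by_cases hi : i.val = 0
    · simp [B, hi]
    · rw [Finset.sum_eq_single ⟨i.val - 1, by omega⟩ _ (by simp)]
      · have h1 : i.val - 1 + 1 = i.val := by omega
        have h2 : j.val = i.val ↔ i = j := by rw [Fin.ext_iff, eq_comm]
        simp [B, h1, hi, h2]
      · intro b _ hb
        have : ¬ i.val = b.val + 1 := fun h => hb (Fin.ext (by simp [h]))
        simp [B, this]
  have hBA : ∀ i j, (Bᴴ * A) i j = if i.val = 1 ∧ j.val = 0 then 1 else 0 := by
    intro i j
    rw [Matrix.mul_apply, Finset.sum_eq_single i₀ _ (by simp)]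
    · simp [A, B, i₀, ← ite_and, and_comm]
    · intro b _ hb
      have : b.val ≠ 0 := fun h => hb (Fin.ext h)
      simp [A, this]
  refine exists_channel_of_pair (A := A) (B := B) ?_ ?_ ?_ ?_
  · intro p q
    simp [A, B, exampleZero, vecMulVec_apply]
  · ext i j
    rw [Matrix.add_apply, hAA, hBB, one_apply]
    by_cases hi : i.val = 0
    · by_cases hj : i = j
      · simp [hi, ← hj]
      · have : j.val ≠ 0 := fun h => hj (Fin.ext (hi.trans h.symm))
        simp [hj, this]
    · simp [hi]
  · intro s t h
    have h1 := congrFun (congrFun h i₀) i₀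
    have h2 := congrFun (congrFun h i₀) i₁
    simp [A, B, i₀, i₁] at h1 h2
    exact ⟨h1, h2⟩
  · rw [Submodule.finrank_eq_zero, Submodule.eq_bot_iff]
    rintro ⟨a, b, z⟩ h
    rw [mem_pairKernel] at h
    have hAB : Aᴴ * B = (Bᴴ * A)ᴴ := by rw [conjTranspose_mul, conjTranspose_conjTranspose]
    have h00 := congrFun (congrFun h i₀) i₀
    have h11 := congrFun (congrFun h i₁) i₁
    have h10 := congrFun (congrFun h i₁) i₀
    simp only [hAB, Matrix.add_apply, Matrix.smul_apply, conjTranspose_apply, hAA, hBB, hBA]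
      at h00 h11 h10
    simp [i₀, i₁] at h00 h11 h10
    simp [h00, h11, h10]

theorem exampleTwo_apply_succ {m : ℕ} (B : BlockMat m) (i a j b : Fin m) :
    exampleTwo B (i.succ, a.succ) (j.succ, b.succ) = B (i, a) (j, b) := by
  rw [exampleTwo, Matrix.add_apply, Matrix.sum_apply, Finset.sum_eq_single (i, a) _ (by simp),
    Matrix.sum_apply, Finset.sum_eq_single (j, b) _ (by simp)]
  · simp [Prod.ext_iff, (Fin.succ_ne_zero _).symm]
  · rintro ⟨j', b'⟩ - h
    simp only [ne_eq, Prod.mk.injEq] at h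
    simp [Prod.ext_iff, h]
  · rintro ⟨i', a'⟩ - h
    simp only [ne_eq, Prod.mk.injEq] at h
    simp [Matrix.sum_apply, Prod.ext_iff, h]

theorem exampleTwo_apply_of_eq_zero {m : ℕ} (B : BlockMat m) (p q : Fin (m + 1) × Fin (m + 1))
    (h : p.1 = 0 ∨ p.2 = 0 ∨ q.1 = 0 ∨ q.2 = 0) :
    exampleTwo B p q = if p = (0, 0) ∧ q = (0, 0) then 1 else 0 := by
  rw [exampleTwo, Matrix.add_apply, Matrix.sum_apply, Finset.sum_eq_zero, add_zero]
  · simp [single_apply, eq_comm]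
  · rintro ⟨i', a'⟩ -
    rw [Matrix.sum_apply, Finset.sum_eq_zero]
    rintro ⟨j', b'⟩ -
    rw [single_apply, if_neg]
    rintro ⟨rfl, rfl⟩
    simp [Fin.succ_ne_zero] at h

/-- The Kraus operators are `1 ⊕ 0` and `0 ⊕ V` with `V` unitary. Their cross products vanish and
`Aᴴ * A`, `Bᴴ * B` are complementary projections, so `a = b = 0` while `z` is an arbitrary complex
number. -/
theorem exampleTwo_spec {m : ℕ} (hm : 1 ≤ m) {M : Mat m →ₗ[ℂ] Mat m} (hM : M ∈ channels m)
    (hr : (choi M).rank = 1) : ∃ L ∈ channels (m + 1),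
      choi L = exampleTwo (choi M) ∧ (choi L).rank = 2 ∧ faceDim L = 2 := by
  obtain ⟨K, -, rfl⟩ := exists_linearIndependent_krausMap hM.1 hr
  have hV : (K 0)ᴴ * K 0 = 1 := by simpa using krausMap_one_mem_channels_iff.1 hM
  have hchoi : ∀ p q, choi (krausMap K 1) p q = K 0 p.2 p.1 * conj (K 0 q.2 q.1) := by
    intro p q
    rw [choi_krausMap_one_apply, Fin.sum_univ_one]
    rfl
  generalize K 0 = V at hV hchoi
  let A : Mat (m + 1) := single 0 0 1
  let B : Mat (m + 1) := Matrix.of (Fin.cons 0 fun a => Fin.cons 0 (V a))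
  have hB0 : ∀ i, B 0 i = 0 := fun i => rfl
  have hB0' : ∀ a, B a 0 = 0 := fun a => by refine Fin.cases ?_ (fun a => ?_) a <;> rfl
  have hBs : ∀ a i, B a.succ i.succ = V a i := fun a i => rfl
  have hA0 : ∀ i j, A i j = if i = 0 ∧ j = 0 then 1 else 0 := fun i j => by
    simp [A, single_apply, eq_comm]
  have hAA : Aᴴ * A = A := by simp [A]
  have hBA : Bᴴ * A = 0 := by
    ext i j
    simp [Matrix.mul_apply, Fin.sum_univ_succ, hB0, hA0]
  have hAB : Aᴴ * B = 0 := by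
    rw [← conjTranspose_conjTranspose (Aᴴ * B), conjTranspose_mul, conjTranspose_conjTranspose,
      hBA, conjTranspose_zero]
  have hBB : Bᴴ * B = 1 - A := by
    ext i j
    rw [Matrix.mul_apply, Matrix.sub_apply, Fin.sum_univ_succ, hA0, one_apply]
    refine Fin.cases ?_ (fun i => ?_) i
    · refine Fin.cases ?_ (fun j => ?_) j <;> simp [hB0, hB0', (Fin.succ_ne_zero _).symm]
    · refine Fin.cases ?_ (fun j => ?_) j
      · simp [hB0, hB0', Fin.succ_ne_zero]
      · have := congrFun (congrFun hV i) j
        rw [Matrix.mul_apply, one_apply] at this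
        simpa [hB0, hBs, Fin.succ_ne_zero] using this
  refine exists_channel_of_pair (A := A) (B := B) ?_ ?_ ?_ ?_
  · rintro ⟨i, a⟩ ⟨j, b⟩
    by_cases h : i = 0 ∨ a = 0 ∨ j = 0 ∨ b = 0
    · rw [exampleTwo_apply_of_eq_zero _ _ _ h]
      have : B a i * conj (B b j) = 0 := by
        rcases h with rfl | rfl | rfl | rfl <;> simp [hB0, hB0']
      simp only [this, hA0, add_zero, Prod.mk.injEq]
      simp [← ite_and, and_comm]
    · push Not at h
      obtain ⟨hi, ha, hj, hb⟩ := h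
      obtain ⟨i, rfl⟩ := Fin.exists_succ_eq.2 hi
      obtain ⟨a, rfl⟩ := Fin.exists_succ_eq.2 ha
      obtain ⟨j, rfl⟩ := Fin.exists_succ_eq.2 hj
      obtain ⟨b, rfl⟩ := Fin.exists_succ_eq.2 hb
      rw [exampleTwo_apply_succ, hchoi]
      simp [hA0, hBs, Fin.succ_ne_zero]
  · rw [hAA, hBB, add_sub_cancel]
  · intro s t h
    have h1 := congrFun (congrFun h 0) 0
    simp [hA0, hB0] at h1
    refine ⟨h1, ?_⟩
    rw [h1, zero_smul, zero_add, smul_eq_zero] at h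
    refine h.resolve_right fun h => ?_
    have h2 := congrFun (congrFun hBB (Fin.succ ⟨0, hm⟩)) (Fin.succ ⟨0, hm⟩)
    simp [h, hA0] at h2
  · let f : ℂ →ₗ[ℝ] ℝ × ℝ × ℂ := LinearMap.inr ℝ ℝ (ℝ × ℂ) ∘ₗ LinearMap.inr ℝ ℝ ℂ
    have hf : Function.Injective f := LinearMap.inr_injective.comp LinearMap.inr_injective
    have : pairKernel A B = LinearMap.range f := by
      ext ⟨a, b, z⟩
      rw [mem_pairKernel, hAA, hBB, hBA, hAB, smul_zero, smul_zero, add_zero, add_zero]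
      constructor
      · intro h
        have h0 := congrFun (congrFun h 0) 0
        have h1 := congrFun (congrFun h (Fin.succ ⟨0, hm⟩)) (Fin.succ ⟨0, hm⟩)
        simp [hA0] at h0
        simp [hA0] at h1
        exact ⟨z, by simp [f, h0, h1]⟩
      · rintro ⟨w, hw⟩
        obtain rfl : 0 = a := congrArg (fun x => x.1) hw
        obtain rfl : 0 = b := congrArg (fun x => x.2.1) hw
        simp
    rw [this, LinearMap.finrank_range_of_inj hf, Complex.finrank_real_complex]

/-- The first coordinates of plane vectors of which `matP` is the Gram matrix. -/
def gramU : Fin 3 → ℝ := ![1, 9 / (4 * √6), 3 / (2 * √6)]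

/-- The second coordinates of plane vectors of which `matP` is the Gram matrix. -/
def gramV : Fin 3 → ℝ := ![0, √10 / 8, -(√10 / 4)]

theorem matP_apply (i j : Fin 3) :
    matP i j = ((gramU i * gramU j + gramV i * gramV j : ℝ) : ℂ) := by
  have h6 : √6 * √6 = 6 := Real.mul_self_sqrt (by norm_num)
  have h10 : √10 * √10 = 10 := Real.mul_self_sqrt (by norm_num)
  have h6' : √6 ≠ 0 := by positivity
  rw [matP, Matrix.map_apply]
  congr 1
  fin_cases i <;> fin_cases j <;> simp [gramU, gramV] <;> field_simp <;> grind

theorem matP_posSemidef : matP.PosSemidef := by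
  have : matP = vecMulVec (fun i => (gramU i : ℂ)) (star fun i => (gramU i : ℂ))
      + vecMulVec (fun i => (gramV i : ℂ)) (star fun i => (gramV i : ℂ)) := by
    ext i j
    simp [matP_apply, vecMulVec_apply]
  rw [this]
  exact (posSemidef_vecMulVec_self_star _).add (posSemidef_vecMulVec_self_star _)

theorem exampleOne_apply (p q : Fin n × Fin n) :
    exampleOne n p q =
      if p.1 = p.2 ∧ q.1 = q.2 then matP (lastThree p.1) (lastThree q.1) else 0 := by
  simp [exampleOne, single_apply]

theorem lastThree_three (i : Fin 3) : lastThree i = i := by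
  fin_cases i <;> rfl

theorem lastThree_succ (i : Fin n) : lastThree i.succ = lastThree i := by
  simp [lastThree]

/-- The Kraus operators are real and diagonal, so the imaginary part of `z` is free. The rest is a
real binary quadratic form vanishing at three pairwise independent plane vectors, hence zero. -/
theorem exampleOne_spec (hn : 3 ≤ n) : ∃ L ∈ channels n,
    choi L = exampleOne n ∧ (choi L).rank = 2 ∧ faceDim L = 1 := by
  let A : Mat n := diagonal fun i => (gramU (lastThree i) : ℂ)
  let B : Mat n := diagonal fun i => (gramV (lastThree i) : ℂ)
  -- One diagonal position is chosen for each of the three Gram vectors; `3 ≤ n` ensures that the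
  -- first class is nonempty.
  obtain ⟨κ, hκ⟩ : ∃ κ : Fin 3 → Fin n, ∀ k, lastThree (κ k) = k := by
    refine ⟨![⟨0, by omega⟩, ⟨n - 2, by omega⟩, ⟨n - 1, by omega⟩], fun k => ?_⟩
    fin_cases k <;> simp [lastThree] <;> grind
  have hU : 0 < gramU 1 ∧ 0 < gramU 2 := by
    constructor <;> simp [gramU]
  have hV1 : 0 < gramV 1 := by simp [gramV]
  -- This ratio lets `b` be eliminated between the last two equations, leaving `z.re` times a
  -- positive number.
  have hV2 : gramV 2 = -2 * gramV 1 := by simp [gramV]; ring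
  have hU0 : gramU 0 = 1 := rfl
  have hV0 : gramV 0 = 0 := rfl
  refine exists_channel_of_pair (A := A) (B := B) ?_ ?_ ?_ ?_
  · rintro ⟨i, a⟩ ⟨j, b⟩
    rw [exampleOne_apply, matP_apply]
    by_cases hi : i = a
    · by_cases hj : j = b
      · simp [A, B, hi, hj]
      · simp [A, B, hj, Ne.symm hj]
    · simp [A, B, hi, Ne.symm hi]
  · have h1 : ∀ k, gramU k * gramU k + gramV k * gramV k = 1 := by
      intro k
      have := matP_apply k k
      rw [matP, Matrix.map_apply, Complex.ofReal_inj] at this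
      rw [← this]
      fin_cases k <;> simp
    simp only [A, B, diagonal_conjTranspose, diagonal_mul_diagonal, diagonal_add]
    rw [← diagonal_one]
    congr 1
    ext i
    simpa using congrArg Complex.ofReal (h1 (lastThree i))
  · intro s t h
    have h0 := congrFun (congrFun h (κ 0)) (κ 0)
    have h1 := congrFun (congrFun h (κ 1)) (κ 1)
    simp [A, B, hκ, hU0, hV0] at h0
    simp [A, B, hκ, h0, hV1.ne'] at h1
    exact ⟨h0, h1⟩
  · have : pairKernel A B = Submodule.span ℝ {((0 : ℝ), (0 : ℝ), Complex.I)} := by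
      ext ⟨a, b, z⟩
      rw [Submodule.mem_span_singleton, mem_pairKernel]
      constructor
      · intro h
        have hk : ∀ k, a * gramU k ^ 2 + b * gramV k ^ 2 + 2 * z.re * (gramU k * gramV k) = 0 := by
          intro k
          have := congrArg Complex.re (congrFun (congrFun h (κ k)) (κ k))
          simp [A, B, hκ] at this
          linarith
        have h0 := hk 0
        have h1 := hk 1
        have h2 := hk 2
        rw [hU0, hV0] at h0
        obtain rfl : a = 0 := by linarith
        rw [hV2] at h2
        have e1 : b * gramV 1 + 2 * z.re * gramU 1 = 0 :=
          mul_right_cancel₀ hV1.ne' (by linarith)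
        have e2 : 2 * b * gramV 1 - 2 * z.re * gramU 2 = 0 :=
          mul_right_cancel₀ hV1.ne' (by linarith)
        have hx : z.re = 0 := by
          have : z.re * (2 * gramU 1 + gramU 2) = 0 := by linarith
          exact (mul_eq_zero.1 this).resolve_right (by linarith [hU.1, hU.2])
        have hb : b = 0 := by
          rw [hx, mul_zero, zero_mul, add_zero] at e1
          exact (mul_eq_zero.1 e1).resolve_right hV1.ne'
        refine ⟨z.im, ?_⟩
        simp [hb, Complex.ext_iff, hx]
      · rintro ⟨t, ht⟩
        obtain rfl : t * 0 = a := congrArg (fun x => x.1) ht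
        obtain rfl : t * 0 = b := congrArg (fun x => x.2.1) ht
        obtain rfl : t • Complex.I = z := congrArg (fun x => x.2.2) ht
        have hc : Aᴴ * B = Bᴴ * A := by
          simp [A, B, diagonal_conjTranspose, diagonal_mul_diagonal, mul_comm]
        simp [hc]
    rw [this, finrank_span_singleton]
    simp

theorem exists_faceDim_eq_two (hn : 2 ≤ n) : ∃ L ∈ channels n,
    (choi L).rank = 2 ∧ faceDim L = 2 := by
  obtain ⟨m, rfl⟩ : ∃ m, n = m + 1 := ⟨n - 1, by omega⟩
  have hm : 1 ≤ m := by omega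
  have : NeZero m := ⟨by omega⟩
  -- The identity channel serves as the channel of Choi rank one.
  let K : Fin 1 → Mat m := fun _ => 1
  have hK : LinearIndependent ℂ K := LinearIndependent.of_subsingleton 0 one_ne_zero
  obtain ⟨L, hL, -, h⟩ := exampleTwo_spec hm (M := krausMap K 1)
    (krausMap_one_mem_channels_iff.2 (by simp [K])) ((linearIndependent_iff_rank_choi K).1 hK)
  exact ⟨L, hL, h⟩

end Examples

end QuantumFaces

end

theorem mainTheorem2 :
    -- the dimensions that occur for `n = 2` are exactly `0` and `2`
    {d : ℕ | ∃ L ∈ QuantumFaces.channels 2,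
        (QuantumFaces.choi L).rank = 2 ∧ QuantumFaces.faceDim L = d} = {0, 2} ∧
    -- the dimensions that occur for each `n ≥ 3` are exactly `0`, `1` and `2`
    (∀ n : ℕ, 3 ≤ n →
      {d : ℕ | ∃ L ∈ QuantumFaces.channels n,
        (QuantumFaces.choi L).rank = 2 ∧ QuantumFaces.faceDim L = d} = {0, 1, 2}) ∧
    -- an explicit example of dimension `0`
    (∀ n : ℕ, 2 ≤ n → ∃ L ∈ QuantumFaces.channels n,
      QuantumFaces.choi L = QuantumFaces.exampleZero n ∧
      (QuantumFaces.choi L).rank = 2 ∧ QuantumFaces.faceDim L = 0) ∧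
    -- examples of dimension `2`, from the channels of Choi rank one in size `m = n - 1`
    (∀ m : ℕ, 1 ≤ m → ∀ M ∈ QuantumFaces.channels m, (QuantumFaces.choi M).rank = 1 →
      ∃ L ∈ QuantumFaces.channels (m + 1),
        QuantumFaces.choi L = QuantumFaces.exampleTwo (QuantumFaces.choi M) ∧
        (QuantumFaces.choi L).rank = 2 ∧ QuantumFaces.faceDim L = 2) ∧
    -- an explicit example of dimension `1`
    (QuantumFaces.matP.PosSemidef ∧
      (QuantumFaces.exampleOne 3).submatrix (fun i => (i, i)) (fun i => (i, i))
        = QuantumFaces.matP ∧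
      (∀ n : ℕ, 3 ≤ n →
        (QuantumFaces.exampleOne (n + 1)).submatrix
          (Prod.map Fin.succ Fin.succ) (Prod.map Fin.succ Fin.succ)
            = QuantumFaces.exampleOne n) ∧
      (∀ n : ℕ, 3 ≤ n → ∃ L ∈ QuantumFaces.channels n,
        QuantumFaces.choi L = QuantumFaces.exampleOne n ∧
        (QuantumFaces.choi L).rank = 2 ∧ QuantumFaces.faceDim L = 1)) := by
  refine ⟨?_, fun n hn => ?_, fun n hn => QuantumFaces.exampleZero_spec hn,
    fun m hm M hM hr => QuantumFaces.exampleTwo_spec hm hM hr,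
    QuantumFaces.matP_posSemidef, ?_, fun n hn => ?_,
    fun n hn => QuantumFaces.exampleOne_spec hn⟩
  · ext d
    constructor
    · rintro ⟨L, hL, hr, rfl⟩
      exact QuantumFaces.faceDim_two hL hr
    · rintro (rfl | rfl)
      · obtain ⟨L, hL, -, h⟩ := QuantumFaces.exampleZero_spec le_rfl
        exact ⟨L, hL, h⟩
      · exact QuantumFaces.exists_faceDim_eq_two le_rfl
  · ext d
    constructor
    · rintro ⟨L, hL, hr, rfl⟩
      have : NeZero n := ⟨by omega⟩
      have := QuantumFaces.faceDim_le_two hL hr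
      simp only [Set.mem_insert_iff, Set.mem_singleton_iff]
      omega
    · rintro (rfl | rfl | rfl)
      · obtain ⟨L, hL, -, h⟩ := QuantumFaces.exampleZero_spec (n := n) (by omega)
        exact ⟨L, hL, h⟩
      · obtain ⟨L, hL, -, h⟩ := QuantumFaces.exampleOne_spec hn
        exact ⟨L, hL, h⟩
      · exact QuantumFaces.exists_faceDim_eq_two (by omega)
  · ext i j
    simp [QuantumFaces.exampleOne_apply, QuantumFaces.lastThree_three]
  · ext p q
    simp [QuantumFaces.exampleOne_apply, QuantumFaces.lastThree_succ]
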